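/- Let $X$ be a finite set. Two permutations of $X$ are disjoint if no element of $X$ is moved by both of them, and similar if they are conjugate in the group $S(X)$ of all permutations of $X$. A permutation of $X$ is called evenly balanced if it can be written as a product $\tau\tau'$ of two disjoint even permutations $\tau,\tau'$ that are similar. An even permutation of $X$ is called decomposable if it is a product of two evenly balanced permutations of $X$. A special atom is a permutation whose cycle decomposition (fixed points omitted) has one of the following types: a single $3$-cycle (type $3$), a single $5$-cycle (type $5$), two disjoint $2$-cycles (type $2\cup 2$), or a disjoint $2$-cycle and $4$-cycle (type $2\cup 4$). Let $\sigma$ be an even permutation of $X$. (1) If $\sigma$ is not a special atom, then $\sigma$ is decomposable. (2) If $|X|\ge 6$ and $\sigma$ is of type $3$, $5$ or $2\cup 2$, then $\sigma$ is decomposable. (3) If $|X|\ge 7$ and $\sigma$ is of type $2\cup 4$, then $\sigma$ is decomposable. (4) Consequently, if $|X|\ge 6$, then either $|X|=6$ and $\sigma$ is the disjoint product of a $2$-cycle and a $4$-cycle, or there exist evenly balanced permutations $\rho,\tau$ of $X$ such that $\sigma=\tau\rho$. The first case is a genuine exception: if $|X|=6$ and $\sigma$ is the disjoint product of a $2$-cycle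 and a $4$-cycle, then $\sigma$ is not decomposable. -/

import Mathlib

/-- `σ` is evenly balanced: it is the product of two disjoint (i.e. with disjoint supports) even
permutations `τ` and `τ'` that are similar (i.e. conjugate in the permutation group of `X`). -/
def EvenlyBalanced {X : Type*} [Fintype X] [DecidableEq X] (σ : Equiv.Perm X) : Prop :=
  ∃ τ τ' : Equiv.Perm X, σ = τ * τ' ∧ Equiv.Perm.Disjoint τ τ' ∧
    Equiv.Perm.sign τ = 1 ∧ Equiv.Perm.sign τ' = 1 ∧ IsConj τ τ'

/-- `σ` is decomposable: it is a product of two evenly balanced permutations of the same set. -/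
def Decomposable {X : Type*} [Fintype X] [DecidableEq X] (σ : Equiv.Perm X) : Prop :=
  ∃ τ ρ : Equiv.Perm X, EvenlyBalanced τ ∧ EvenlyBalanced ρ ∧ σ = τ * ρ

/-- The four special atoms: a 3-cycle, a 5-cycle, a disjoint product of two 2-cycles, and a
disjoint product of a 2-cycle and a 4-cycle. (`Equiv.Perm.cycleType` is the multiset of the lengths
of the cycles in the cycle decomposition, fixed points not counted.) -/
def IsSpecialAtom {X : Type*} [Fintype X] [DecidableEq X] (σ : Equiv.Perm X) : Prop :=
  σ.cycleType = {3} ∨ σ.cycleType = {5} ∨ σ.cycleType = {2, 2} ∨ σ.cycleType = {2, 4}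

/-! Everything depends only on cycle types. A permutation is evenly balanced iff its cycle type is
`k + k` with `k` the type of an even permutation (`evenlyBalanced_iff`). Decomposability is
conjugation invariant, survives adding fixed points, and is additive over disjoint unions
(`DecomposableTypeOn.add`), so one may split a type into decomposable pieces.

Infinitely many types come from finitely many explicit factorizations by lengthening cycles. If `ρ`
fixes a point `y` of a cycle of `τ * ρ`, multiply on the right by a 7-cycle through `y` and six new
points. That 7-cycle is a product of two permutations of type `{3, 3}`: the first, on new points
only, is absorbed by `τ`, the second, meeting the old points only in `y`, by `ρ`. The cycle grows by
6, and one new point is fixed by the new right factor, so the step can be repeated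
(`ExtendableType.add_six`).

A nonspecial even type is then treated by strong induction on its sum: remove a known decomposable
piece. If what remains is a special atom, a different piece is removed or the whole type is already
known (`IsEvenType.decomposableTypeOn`). Special atoms are factored explicitly once there is room.
On six points a nontrivial evenly balanced permutation has type `{3, 3}`, and a finite check shows
that no product of two such has order 4, which rules out `{2, 4}`. -/

open Equiv Equiv.Perm

/-! ### Evenly balanced permutations in terms of cycle types -/

section EvenlyBalanced

variable {α : Type*} [Fintype α] [DecidableEq α]

theorem sign_eq_one_iff_cycleType (σ : Perm α) :
    sign σ = 1 ↔ Even (σ.cycleType.sum + Multiset.card σ.cycleType) := by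
  rw [sign_of_cycleType]
  exact neg_one_pow_eq_one_iff_even (by decide)

theorem EvenlyBalanced.conj {σ : Perm α} (h : EvenlyBalanced σ) (g : Perm α) :
    EvenlyBalanced (g * σ * g⁻¹) := by
  obtain ⟨τ, τ', rfl, hd, h1, h2, hc⟩ := h
  refine ⟨g * τ * g⁻¹, g * τ' * g⁻¹, by group, hd.conj g, by simp [h1], by simp [h2], ?_⟩
  rw [isConj_iff_cycleType_eq] at hc ⊢
  simpa using hc

theorem EvenlyBalanced.exists_cycleType {σ : Perm α} (h : EvenlyBalanced σ) :
    ∃ k : Multiset ℕ, σ.cycleType = k + k ∧ Even (k.sum + Multiset.card k) := by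
  obtain ⟨τ, τ', rfl, hd, h1, h2, hc⟩ := h
  rw [isConj_iff_cycleType_eq] at hc
  exact ⟨τ.cycleType, by rw [hd.cycleType_mul, ← hc], (sign_eq_one_iff_cycleType τ).1 h1⟩

/-- Since `2 * k.sum` points are available, a permutation of type `k` can be chosen and then a
second one off its support. Their product is evenly balanced and conjugate to `σ`. -/
theorem evenlyBalanced_of_cycleType {σ : Perm α} {k : Multiset ℕ} (h : σ.cycleType = k + k)
    (hk : Even (k.sum + Multiset.card k)) : EvenlyBalanced σ := by
  have hsum : k.sum + k.sum ≤ Fintype.card α := by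
    rw [← Multiset.sum_add, ← h]; exact sum_cycleType_le σ
  have h2 : ∀ a ∈ k, 2 ≤ a := fun a ha =>
    two_le_of_mem_cycleType (σ := σ) (by rw [h]; exact Multiset.mem_add.2 (Or.inl ha))
  obtain ⟨g₁, hg₁⟩ := (exists_with_cycleType_iff (α := α)).2 ⟨by omega, h2⟩
  have hcard : Fintype.card {x // x ∉ g₁.support} = Fintype.card α - k.sum := by
    rw [Fintype.card_subtype_compl, ← hg₁, sum_cycleType, Fintype.card_coe]
  obtain ⟨g₂, hg₂⟩ := (exists_with_cycleType_iff (α := {x // x ∉ g₁.support}) (m := k)).2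
    ⟨by omega, h2⟩
  have hd : Perm.Disjoint g₁ (ofSubtype g₂) := by
    intro x
    by_cases hx : x ∈ g₁.support
    · exact Or.inr (ofSubtype_apply_of_not_mem g₂ (by simpa using hx))
    · exact Or.inl (notMem_support.1 hx)
  have hg₂' : (ofSubtype g₂).cycleType = k := by rw [cycleType_ofSubtype]; exact hg₂
  have hb : EvenlyBalanced (g₁ * ofSubtype g₂) :=
    ⟨g₁, _, rfl, hd, (sign_eq_one_iff_cycleType _).2 (by rwa [hg₁]),
      (sign_eq_one_iff_cycleType _).2 (by rwa [hg₂']),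
      isConj_iff_cycleType_eq.2 (by rw [hg₁, hg₂'])⟩
  obtain ⟨g, rfl⟩ := isConj_iff.1 (isConj_iff_cycleType_eq.2
    (show (g₁ * ofSubtype g₂).cycleType = σ.cycleType by rw [hd.cycleType_mul, hg₁, hg₂', h]))
  exact hb.conj g

theorem evenlyBalanced_iff {σ : Perm α} : EvenlyBalanced σ ↔
    ∃ k : Multiset ℕ, σ.cycleType = k + k ∧ Even (k.sum + Multiset.card k) :=
  ⟨EvenlyBalanced.exists_cycleType, fun ⟨_, h, hk⟩ => evenlyBalanced_of_cycleType h hk⟩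

theorem EvenlyBalanced.of_cycleType_eq {β : Type*} [Fintype β] [DecidableEq β] {σ : Perm α}
    {τ : Perm β} (h : EvenlyBalanced σ) (hc : τ.cycleType = σ.cycleType) : EvenlyBalanced τ := by
  rw [evenlyBalanced_iff] at h ⊢
  rwa [hc]

theorem EvenlyBalanced.inv {σ : Perm α} (h : EvenlyBalanced σ) : EvenlyBalanced σ⁻¹ :=
  h.of_cycleType_eq (cycleType_inv σ)

theorem EvenlyBalanced.mul_of_disjoint {σ τ : Perm α} (hσ : EvenlyBalanced σ)
    (hτ : EvenlyBalanced τ) (hd : Perm.Disjoint σ τ) : EvenlyBalanced (σ * τ) := by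
  rw [evenlyBalanced_iff] at hσ hτ ⊢
  obtain ⟨k, hk, hk'⟩ := hσ
  obtain ⟨l, hl, hl'⟩ := hτ
  refine ⟨k + l, by rw [hd.cycleType_mul, hk, hl]; abel, ?_⟩
  rw [Multiset.sum_add, Multiset.card_add]
  rw [add_add_add_comm]
  exact hk'.add hl'

theorem evenlyBalanced_one : EvenlyBalanced (1 : Perm α) :=
  evenlyBalanced_iff.2 ⟨0, by simp, by simp⟩

theorem Decomposable.conj {σ : Perm α} (h : Decomposable σ) (g : Perm α) :
    Decomposable (g * σ * g⁻¹) := by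
  obtain ⟨τ, ρ, hτ, hρ, rfl⟩ := h
  exact ⟨_, _, hτ.conj g, hρ.conj g, by group⟩

end EvenlyBalanced

/-! ### Permutations of a disjoint union -/

section Sum

variable {α β : Type*} [Fintype α] [DecidableEq α] [Fintype β] [DecidableEq β]

theorem cycleType_sumCongr_one_right (σ : Perm α) :
    (Perm.sumCongr σ (1 : Perm β)).cycleType = σ.cycleType := by
  have h : Perm.sumCongr σ (1 : Perm β) =
      σ.extendDomain (Equiv.ofInjective (Sum.inl : α → α ⊕ β) Sum.inl_injective) := by
    ext x
    rcases x with a | b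
    · exact (extendDomain_apply_image σ
        (Equiv.ofInjective (Sum.inl : α → α ⊕ β) Sum.inl_injective) a).symm
    · rw [extendDomain_apply_not_subtype _ _ (by simp)]; rfl
  rw [h, cycleType_extendDomain]

theorem cycleType_sumCongr_one_left (τ : Perm β) :
    (Perm.sumCongr (1 : Perm α) τ).cycleType = τ.cycleType := by
  have h : Perm.sumCongr (1 : Perm α) τ =
      τ.extendDomain (Equiv.ofInjective (Sum.inr : β → α ⊕ β) Sum.inr_injective) := by
    ext x
    rcases x with a | b
    · rw [extendDomain_apply_not_subtype _ _ (by simp)]; rfl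
    · exact (extendDomain_apply_image τ
        (Equiv.ofInjective (Sum.inr : β → α ⊕ β) Sum.inr_injective) b).symm
  rw [h, cycleType_extendDomain]

omit [Fintype α] [DecidableEq α] [Fintype β] [DecidableEq β] in
theorem disjoint_sumCongr (σ : Perm α) (τ : Perm β) :
    Perm.Disjoint (Perm.sumCongr σ (1 : Perm β)) (Perm.sumCongr (1 : Perm α) τ) := by
  rintro (a | b)
  · exact Or.inr rfl
  · exact Or.inl rfl

theorem cycleType_sumCongr (σ : Perm α) (τ : Perm β) :
    (Perm.sumCongr σ τ).cycleType = σ.cycleType + τ.cycleType := by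
  rw [← cycleType_sumCongr_one_right (β := β) σ, ← cycleType_sumCongr_one_left (α := α) τ,
    ← (disjoint_sumCongr σ τ).cycleType_mul, Perm.sumCongr_mul, one_mul, mul_one]

theorem EvenlyBalanced.sumCongr {σ : Perm α} {τ : Perm β} (hσ : EvenlyBalanced σ)
    (hτ : EvenlyBalanced τ) : EvenlyBalanced (Perm.sumCongr σ τ) := by
  have := (hσ.of_cycleType_eq (cycleType_sumCongr_one_right (β := β) σ)).mul_of_disjoint
    (hτ.of_cycleType_eq (cycleType_sumCongr_one_left (α := α) τ)) (disjoint_sumCongr σ τ)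
  rwa [Perm.sumCongr_mul, one_mul, mul_one] at this

end Sum

/-! ### Lengthening a cycle by fixed points -/

section Lengthen

theorem Equiv.Perm.SameCycle.of_forall_apply {α : Type*} {f g : Perm α} (h : ∀ w, SameCycle g w (f w)) {x y : α}
    (hxy : SameCycle f x y) : SameCycle g x y := by
  obtain ⟨i, rfl⟩ := hxy
  have hn : ∀ (n : ℕ) (x : α), SameCycle g x ((f ^ n) x) := by
    intro n
    induction n with
    | zero => intro x; exact SameCycle.refl g x
    | succ n ih => intro x; rw [pow_succ, Perm.mul_apply]; exact (h x).trans (ih (f x))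
  cases i with
  | ofNat n => simpa using hn n x
  | negSucc n =>
    have := hn (n + 1) ((f ^ (Int.negSucc n)) x)
    rw [← Perm.mul_apply, zpow_negSucc, mul_inv_cancel, one_apply] at this
    rw [zpow_negSucc]
    exact this.symm

variable {α : Type*} [DecidableEq α]

theorem sameCycle_mul_swap {σ : Perm α} {y z : α} (hz : σ z = z) :
    SameCycle (σ * swap y z) y z := ⟨1, by simp [hz]⟩

theorem Equiv.Perm.SameCycle.mul_swap {σ : Perm α} {y z : α} (hz : σ z = z) {x w : α}
    (h : SameCycle σ x w) : SameCycle (σ * swap y z) x w := by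
  refine h.of_forall_apply fun v => ?_
  by_cases hv : v = y
  · subst hv
    exact ⟨2, by rw [zpow_two]; simp [hz]⟩
  by_cases hv' : v = z
  · subst hv'
    rw [hz]
  · exact ⟨1, by simp [swap_apply_of_ne_of_ne hv hv']⟩

/-- Right multiplication by `swap y z` with `z` fixed inserts `z` between `y` and `σ y`. Iterating
along the list, with each inserted point as the next base point, inserts all of `l` and never
separates points of one cycle. -/
theorem Equiv.Perm.SameCycle.mul_formPerm {l : List α} : ∀ {σ : Perm α} {y : α},
    (y :: l).Nodup → (∀ z ∈ l, σ z = z) →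
    (∀ {x w}, SameCycle σ x w → SameCycle (σ * (y :: l).formPerm) x w) ∧
      ∀ z ∈ l, SameCycle (σ * (y :: l).formPerm) y z := by
  induction l with
  | nil => intro σ y _ _; simp
  | cons z l ih =>
    intro σ y hn hf
    have hz := hf z (by simp)
    obtain ⟨h₁, h₂⟩ := ih (σ := σ * swap y z) (y := z) (List.nodup_cons.1 hn).2 (by
      intro w hw
      rw [Perm.mul_apply, swap_apply_of_ne_of_ne, hf w (by simp [hw])]
      · rintro rfl; simp [hw] at hn
      · rintro rfl; simp [hw] at hn)
    rw [List.formPerm_cons_cons, ← mul_assoc]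
    refine ⟨fun h => h₁ (h.mul_swap hz), ?_⟩
    intro w hw
    rcases List.mem_cons.1 hw with rfl | hw
    · exact h₁ (sameCycle_mul_swap hz)
    · exact (h₁ (sameCycle_mul_swap hz)).trans (h₂ w hw)

theorem List.formPerm_append_mul_formPerm_cons (t : List α) (y : α) (l : List α) :
    (t ++ [y]).formPerm * (y :: l).formPerm = (t ++ y :: l).formPerm := by
  induction t with
  | nil => simp
  | cons a t ih =>
    cases t with
    | nil => simp
    | cons b t =>
      simp only [List.cons_append, List.formPerm_cons_cons] at ih ⊢
      rw [mul_assoc, ih]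

/-- Two cycles sharing exactly the point `y` multiply to one cycle, obtained by concatenating their
lists at `y`. The other cycles of `σ` are untouched. -/
theorem cycleType_mul_formPerm [Fintype α] {σ : Perm α} {y : α} {l : List α} (hn : (y :: l).Nodup)
    (hf : ∀ z ∈ l, σ z = z) (hy : σ y ≠ y) {r : Multiset ℕ}
    (hr : σ.cycleType = (σ.cycleOf y).support.card ::ₘ r) :
    (σ * (y :: l).formPerm).cycleType = ((σ.cycleOf y).support.card + l.length) ::ₘ r := by
  set c := σ.cycleOf y with hc
  have hcm : c ∈ σ.cycleFactorsFinset := cycleOf_mem_cycleFactorsFinset_iff.2 (by simpa using hy)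
  have hd : Perm.Disjoint (σ * c⁻¹) c := disjoint_mul_inv_of_mem_cycleFactorsFinset hcm
  have hσ : σ = σ * c⁻¹ * c := by group
  have hcyc : c.IsCycle := isCycle_cycleOf σ hy
  have hrt : (σ * c⁻¹).cycleType = r := by
    have := hd.cycleType_mul
    rw [← hσ, hr, hcyc.cycleType, add_comm, Multiset.singleton_add] at this
    exact (Multiset.cons_inj_right _).1 this.symm
  -- The cycle of `y` is listed with `y` last, by rotating `σ.toList y` one place, so that it can be
  -- joined to `y :: l`.
  obtain ⟨t, ht, htn, htl⟩ : ∃ t : List α, (t ++ [y]).formPerm = c ∧ (t ++ [y]).Nodup ∧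
      t.length + 1 = c.support.card := by
    have hys : y ∈ σ.support := by simpa using hy
    have hmem : y ∈ σ.toList y := mem_toList_iff.2 ⟨SameCycle.refl _ _, hys⟩
    have hlen := length_toList σ y
    have h0 : (σ.toList y)[0]? = some y := by
      rw [List.getElem?_eq_getElem (length_toList_pos_of_mem_support σ y hys),
        toList_getElem_zero σ y hys]
    have hnd := nodup_toList σ y
    have hfp := formPerm_toList σ y
    generalize σ.toList y = L at *
    cases L with
    | nil => simp at hmem
    | cons a t =>
      have ha : a = y := by simpa using h0
      subst ha
      refine ⟨t, ?_, ?_, by simpa using hlen⟩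
      · rw [hc, ← hfp, ← List.formPerm_rotate _ hnd 1]; simp
      · simpa using (List.nodup_rotate (n := 1)).2 hnd
  have hts : ∀ w ∈ t ++ [y], w ∈ c.support := by
    intro w hw
    rw [← ht, List.support_formPerm_of_nodup _ htn]
    · exact List.mem_toFinset.2 hw
    · intro x hx
      have h2 := two_le_card_support_cycleOf_iff.2 hy
      have := congrArg List.length hx
      simp at this
      rw [← hc, ← htl, this] at h2
      simp at h2
  have hnd : (t ++ y :: l).Nodup := by
    rw [List.nodup_append'] at htn ⊢
    refine ⟨htn.1, hn, ?_⟩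
    intro w hw hw'
    rcases List.mem_cons.1 hw' with rfl | hw'
    · exact htn.2.2 hw (by simp)
    · have := mem_cycleFactorsFinset_support_le hcm (hts w (by simp [hw]))
      exact (mem_support.1 this) (hf w hw')
  have hlen : c.support.card + l.length = (t ++ y :: l).length := by
    rw [← htl]; simp; omega
  have h2 := two_le_card_support_cycleOf_iff.2 hy
  rw [← hc] at h2
  have hkey : σ * (y :: l).formPerm = (σ * c⁻¹) * (t ++ y :: l).formPerm := by
    rw [← List.formPerm_append_mul_formPerm_cons, ht]; group
  have hd' : Perm.Disjoint (σ * c⁻¹) (t ++ y :: l).formPerm := by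
    intro w
    by_cases hw : w ∈ t ++ y :: l
    · left
      by_cases hw' : w ∈ t ++ [y]
      · exact (hd w).resolve_right (mem_support.1 (hts w hw'))
      · have hwl : w ∈ l := by
          simp only [List.mem_append, List.mem_cons, List.not_mem_nil, or_false] at hw hw'
          tauto
        have hcw : c⁻¹ w = w := by
          rw [inv_eq_iff_eq, eq_comm, ← notMem_support]
          exact fun h => (mem_support.1 (mem_cycleFactorsFinset_support_le hcm h)) (hf w hwl)
        rw [Perm.mul_apply, hcw, hf w hwl]
    · exact Or.inr (List.formPerm_apply_of_notMem hw)
  rw [hkey, hd'.cycleType_mul, hrt, (List.isCycle_formPerm hnd (by omega)).cycleType,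
    List.support_formPerm_of_nodup _ hnd, List.toFinset_card_of_nodup hnd, hlen, add_comm,
    Multiset.singleton_add]
  intro x hx
  have := congrArg List.length hx
  simp only [List.length_singleton] at this
  omega

end Lengthen

/-! ### Decomposable and extendable cycle types -/

/-- Some set with `N` elements carries two evenly balanced permutations whose product has cycle
type `m`. -/
def DecomposableTypeOn (N : ℕ) (m : Multiset ℕ) : Prop :=
  ∃ (α : Type) (_ : Fintype α) (_ : DecidableEq α) (τ ρ : Perm α), Fintype.card α = N ∧
    EvenlyBalanced τ ∧ EvenlyBalanced ρ ∧ (τ * ρ).cycleType = m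

/-- `m` is the cycle type of a fixed-point-free product `τ * ρ` of evenly balanced permutations
such that each cycle of `τ * ρ` contains a point fixed by `τ` or by `ρ`. -/
def ExtendableType (m : Multiset ℕ) : Prop :=
  ∃ (α : Type) (_ : Fintype α) (_ : DecidableEq α) (τ ρ : Perm α), Fintype.card α = m.sum ∧
    EvenlyBalanced τ ∧ EvenlyBalanced ρ ∧ (τ * ρ).cycleType = m ∧
    ∀ x, ∃ y, SameCycle (τ * ρ) x y ∧ (τ y = y ∨ ρ y = y)

theorem ExtendableType.decomposableTypeOn {m : Multiset ℕ} (h : ExtendableType m) :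
    DecomposableTypeOn m.sum m := by
  obtain ⟨α, _, _, τ, ρ, h₁, h₂, h₃, h₄, -⟩ := h
  exact ⟨α, _, _, τ, ρ, h₁, h₂, h₃, h₄⟩

theorem DecomposableTypeOn.decomposable {X : Type*} [Fintype X] [DecidableEq X] {σ : Perm X} {N : ℕ}
    (h : DecomposableTypeOn N σ.cycleType) (hN : N ≤ Fintype.card X) : Decomposable σ := by
  obtain ⟨α, _, _, τ, ρ, rfl, hτ, hρ, hm⟩ := h
  obtain ⟨e⟩ := Function.Embedding.nonempty_of_card_le hN
  have hc (g : Perm α) : (g.extendDomain (Equiv.ofInjective e e.injective)).cycleType =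
      g.cycleType := cycleType_extendDomain _
  obtain ⟨g, hg⟩ := isConj_iff.1 (isConj_iff_cycleType_eq.2 ((hc (τ * ρ)).trans hm))
  rw [← hg]
  exact Decomposable.conj ⟨_, _, hτ.of_cycleType_eq (hc τ), hρ.of_cycleType_eq (hc ρ),
    (extendDomain_mul _ τ ρ).symm⟩ g

theorem DecomposableTypeOn.add {M N : ℕ} {m n : Multiset ℕ} (hm : DecomposableTypeOn M m)
    (hn : DecomposableTypeOn N n) : DecomposableTypeOn (M + N) (m + n) := by
  obtain ⟨α, _, _, τ, ρ, rfl, hτ, hρ, rfl⟩ := hm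
  obtain ⟨β, _, _, τ', ρ', rfl, hτ', hρ', rfl⟩ := hn
  exact ⟨α ⊕ β, inferInstance, inferInstance, Perm.sumCongr τ τ', Perm.sumCongr ρ ρ',
    Fintype.card_sum, hτ.sumCongr hτ', hρ.sumCongr hρ', by
      rw [Perm.sumCongr_mul, cycleType_sumCongr]⟩

theorem decomposableTypeOn_zero : DecomposableTypeOn 0 0 :=
  ⟨Empty, inferInstance, inferInstance, 1, 1, rfl, evenlyBalanced_one, evenlyBalanced_one, by simp⟩

/-! ### Explicit factorizations as checkable data -/

section Extension

theorem pairwise_disjoint_map_formPerm {α : Type*} [DecidableEq α] {L : List (List α)}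
    (hn : L.flatten.Nodup) : (L.map List.formPerm).Pairwise Perm.Disjoint := by
  rw [List.pairwise_map]
  rw [List.nodup_flatten] at hn
  refine hn.2.imp ?_
  intro l l' h x
  by_cases hx : x ∈ l
  · exact Or.inr (List.formPerm_apply_of_notMem fun hx' => h hx hx')
  · exact Or.inl (List.formPerm_apply_of_notMem hx)

theorem cycleType_prod_map_formPerm {α : Type*} [Fintype α] [DecidableEq α] {L : List (List α)}
    (hn : L.flatten.Nodup) (h2 : ∀ l ∈ L, 2 ≤ l.length) :
    (L.map List.formPerm).prod.cycleType = (L.map List.length : Multiset ℕ) := by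
  have hnl : ∀ l ∈ L, l.Nodup := (List.nodup_flatten.1 hn).1
  rw [cycleType_eq (L.map List.formPerm) rfl _ (pairwise_disjoint_map_formPerm hn)]
  · rw [List.map_map]
    congr 1
    refine List.map_congr_left fun l hl => ?_
    rw [Function.comp_apply, Function.comp_apply, List.support_formPerm_of_nodup _ (hnl l hl),
      List.toFinset_card_of_nodup (hnl l hl)]
    rintro x rfl
    simpa using h2 _ hl
  · intro g hg
    obtain ⟨l, hl, rfl⟩ := List.mem_map.1 hg
    exact List.isCycle_formPerm (hnl l hl) (h2 l hl)

theorem sameCycle_prod_map_formPerm {α : Type*} [Fintype α] [DecidableEq α] {L : List (List α)}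
    (hn : L.flatten.Nodup) {l : List α} (hl : l ∈ L) (h2 : 2 ≤ l.length) {x y : α} (hx : x ∈ l)
    (hy : y ∈ l) : SameCycle (L.map List.formPerm).prod x y := by
  have hnl : l.Nodup := (List.nodup_flatten.1 hn).1 l hl
  have hl1 (z : α) : l ≠ [z] := by rintro rfl; simp at h2
  have hm (z : α) (hz : z ∈ l) : l.formPerm z ≠ z := by
    rw [← mem_support, List.support_formPerm_of_nodup _ hnl hl1]
    exact List.mem_toFinset.2 hz
  refine SameCycle.of_forall_apply (f := l.formPerm) (fun w => ?_)
    ((List.isCycle_formPerm hnl h2).sameCycle (hm x hx) (hm y hy))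
  by_cases hw : l.formPerm w = w
  · rw [hw]
  · exact ⟨1, by
      rw [zpow_one, ← eq_on_support_mem_disjoint (List.mem_map_of_mem hl)
        (pairwise_disjoint_map_formPerm hn) w (mem_support.2 hw)]⟩

theorem evenlyBalanced_prod_map_formPerm {α : Type*} [Fintype α] [DecidableEq α]
    {L L' : List (List α)} (hn : (L ++ L').flatten.Nodup) (h2 : ∀ l ∈ L ++ L', 2 ≤ l.length)
    (hl : L.map List.length = L'.map List.length)
    (he : Even ((L.map List.length).sum + L.length)) :
    EvenlyBalanced ((L ++ L').map List.formPerm).prod := by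
  refine evenlyBalanced_iff.2 ⟨(L.map List.length : Multiset ℕ), ?_, by simpa using he⟩
  rw [cycleType_prod_map_formPerm hn h2, List.map_append, ← hl, Multiset.coe_add]

/-- An explicit factorization of a permutation with cycles `cyc` into the permutations with cycles
`left ++ left'` and `right ++ right'`. -/
structure Factorization where
  size : ℕ
  left : List (List (Fin size))
  left' : List (List (Fin size))
  right : List (List (Fin size))
  right' : List (List (Fin size))
  cyc : List (List (Fin size))

namespace Factorization

/-- The cycle type of the factored permutation. -/
def type (F : Factorization) : Multiset ℕ := (F.cyc.map List.length : List ℕ)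

/-- The left factor. -/
def leftPerm (F : Factorization) : Perm (Fin F.size) :=
  ((F.left ++ F.left').map List.formPerm).prod

/-- The right factor. -/
def rightPerm (F : Factorization) : Perm (Fin F.size) :=
  ((F.right ++ F.right').map List.formPerm).prod

/-- Both factors are evenly balanced and their product is the permutation with cycles `cyc`. -/
def Valid (F : Factorization) : Prop :=
  ((F.left ++ F.left').flatten.Nodup ∧ (∀ l ∈ F.left ++ F.left', 2 ≤ l.length) ∧
    F.left.map List.length = F.left'.map List.length ∧
    Even ((F.left.map List.length).sum + F.left.length)) ∧
  ((F.right ++ F.right').flatten.Nodup ∧ (∀ l ∈ F.right ++ F.right', 2 ≤ l.length) ∧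
    F.right.map List.length = F.right'.map List.length ∧
    Even ((F.right.map List.length).sum + F.right.length)) ∧
  F.cyc.flatten.Nodup ∧ (∀ l ∈ F.cyc, 2 ≤ l.length) ∧
  ∀ x, F.leftPerm (F.rightPerm x) = (F.cyc.map List.formPerm).prod x

instance : DecidablePred Valid := fun F => by unfold Valid; infer_instance

/-- Each point lies on one of the given cycles, which contains a point fixed by a factor. -/
def Extendable (F : Factorization) : Prop :=
  F.size = (F.cyc.map List.length).sum ∧
  ∀ x, ∃ l ∈ F.cyc, x ∈ l ∧ ∃ y ∈ l, F.leftPerm y = y ∨ F.rightPerm y = y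

instance : DecidablePred Extendable := fun F => by unfold Extendable; infer_instance

theorem Valid.mul_eq {F : Factorization} (h : F.Valid) :
    F.leftPerm * F.rightPerm = (F.cyc.map List.formPerm).prod :=
  Equiv.ext h.2.2.2.2

theorem Valid.decomposableTypeOn {F : Factorization} (h : F.Valid) :
    DecomposableTypeOn F.size F.type := by
  have hm := h.mul_eq
  obtain ⟨⟨a₁, a₂, a₃, a₄⟩, ⟨b₁, b₂, b₃, b₄⟩, c₁, c₂, -⟩ := h
  refine ⟨Fin F.size, inferInstance, inferInstance, F.leftPerm, F.rightPerm, Fintype.card_fin _,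
    evenlyBalanced_prod_map_formPerm a₁ a₂ a₃ a₄, evenlyBalanced_prod_map_formPerm b₁ b₂ b₃ b₄, ?_⟩
  rw [hm, cycleType_prod_map_formPerm c₁ c₂, type]

theorem Valid.extendableType {F : Factorization} (h : F.Valid) (h' : F.Extendable) :
    ExtendableType F.type := by
  have hm := h.mul_eq
  obtain ⟨⟨a₁, a₂, a₃, a₄⟩, ⟨b₁, b₂, b₃, b₄⟩, c₁, c₂, -⟩ := h
  refine ⟨Fin F.size, inferInstance, inferInstance, F.leftPerm, F.rightPerm, ?_,
    evenlyBalanced_prod_map_formPerm a₁ a₂ a₃ a₄, evenlyBalanced_prod_map_formPerm b₁ b₂ b₃ b₄,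
    ?_, ?_⟩
  · rw [Fintype.card_fin, type, Multiset.sum_coe, ← h'.1]
  · rw [hm, cycleType_prod_map_formPerm c₁ c₂, type]
  · intro x
    obtain ⟨l, hl, hx, y, hy, hxy⟩ := h'.2 x
    exact ⟨y, hm ▸ sameCycle_prod_map_formPerm c₁ hl (c₂ l hl) hx hy, hxy⟩

end Factorization

end Extension

/-! ### Adding six points to a cycle -/

section AddSix

variable {α : Type*} [DecidableEq α]

/-- The six new points. -/
def newPoints (α : Type*) : List (α ⊕ Fin 6) := (List.finRange 6).map Sum.inr

omit [DecidableEq α] in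
theorem nodup_cons_newPoints (y : α) : (Sum.inl y :: newPoints α).Nodup := by
  simp [newPoints, List.nodup_map_iff Sum.inr_injective, List.nodup_finRange]

/-- Both factors have type `{3, 3}`. The first avoids the old points; the second meets them only in
`y` and leaves the new point 0 fixed. -/
theorem formPerm_cons_newPoints (y : α) :
    (Sum.inl y :: newPoints α).formPerm =
      Perm.sumCongr (1 : Perm α) ([[0, 1, 3], [2, 5, 4]].map List.formPerm).prod *
        ([[Sum.inr 1, Sum.inr 4, Sum.inr 2],
          [Sum.inr 3, Sum.inr 5, Sum.inl y]].map List.formPerm).prod := by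
  have h6 : List.finRange 6 = [0, 1, 2, 3, 4, 5] := by decide
  ext x
  rcases x with a | i
  · by_cases ha : a = y
    · subst ha
      simp [newPoints, h6, swap_apply_def]
    · simp [newPoints, h6, swap_apply_def, ha]
  · fin_cases i <;> simp [newPoints, h6, swap_apply_def]

end AddSix

theorem eq_cycleOf_of_disjoint {α : Type*} [Fintype α] [DecidableEq α] {f c g : Perm α}
    (hf : f = c * g) (hd : Perm.Disjoint c g) (hc : c.IsCycle) {x : α} (hx : x ∈ c.support) :
    c = f.cycleOf x := by
  refine cycle_is_cycleOf hx ?_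
  rw [hf, hd.cycleFactorsFinset_mul_eq_union, hc.cycleFactorsFinset_eq_singleton]
  simp

section SumCongr

variable {α β : Type*}

theorem Equiv.Perm.SameCycle.sumCongr_one {σ : Perm α} {x w : α} (h : SameCycle σ x w) :
    SameCycle (Perm.sumCongr σ (1 : Perm β)) (Sum.inl x) (Sum.inl w) := by
  obtain ⟨i, rfl⟩ := h
  have hi : Perm.sumCongr σ (1 : Perm β) ^ i = Perm.sumCongr (σ ^ i) 1 := by
    have := map_zpow (sumCongrHom α β) (σ, 1) i
    rw [Prod.pow_mk, one_zpow] at this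
    exact this.symm
  exact ⟨i, by rw [hi]; simp⟩

theorem cycleOf_sumCongr_one [Fintype α] [DecidableEq α] [Fintype β] [DecidableEq β] {σ : Perm α}
    {y : α} (hy : σ y ≠ y) : (Perm.sumCongr σ (1 : Perm β)).cycleOf (Sum.inl y) =
      Perm.sumCongr (σ.cycleOf y) 1 := by
  have hcm : σ.cycleOf y ∈ σ.cycleFactorsFinset :=
    cycleOf_mem_cycleFactorsFinset_iff.2 (mem_support.2 hy)
  have hd := disjoint_mul_inv_of_mem_cycleFactorsFinset hcm
  refine (eq_cycleOf_of_disjoint (g := Perm.sumCongr (σ * (σ.cycleOf y)⁻¹) (1 : Perm β))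
    ?_ ?_ ?_ ?_).symm
  · rw [Perm.sumCongr_mul, ← hd.commute.eq, inv_mul_cancel_right, mul_one]
  · rintro (x | x)
    · simpa [Sum.inl_injective.eq_iff] using hd.symm x
    · simp
  · rw [← card_cycleType_eq_one, cycleType_sumCongr_one_right, card_cycleType_eq_one]
    exact isCycle_cycleOf σ hy
  · rw [mem_support]
    simpa [Sum.inl_injective.eq_iff] using hy

end SumCongr

theorem extendableType_add_six {α : Type} [Fintype α] [DecidableEq α] {τ ρ : Perm α}
    (hτ : EvenlyBalanced τ) (hρ : EvenlyBalanced ρ)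
    (hfix : ∀ x, ∃ y, SameCycle (τ * ρ) x y ∧ (τ y = y ∨ ρ y = y)) {y : α} (hy : ρ y = y)
    (hy' : (τ * ρ) y ≠ y) {r : Multiset ℕ}
    (hr : (τ * ρ).cycleType = ((τ * ρ).cycleOf y).support.card ::ₘ r)
    (hcard : Fintype.card α = (τ * ρ).cycleType.sum) :
    ExtendableType ((((τ * ρ).cycleOf y).support.card + 6) ::ₘ r) := by
  set a : Perm (Fin 6) := ([[0, 1, 3], [2, 5, 4]].map List.formPerm).prod with ha
  set b : Perm (α ⊕ Fin 6) := ([[Sum.inr 1, Sum.inr 4, Sum.inr 2],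
          [Sum.inr 3, Sum.inr 5, Sum.inl y]].map List.formPerm).prod with hb
  have hea : EvenlyBalanced a :=
    evenlyBalanced_prod_map_formPerm (L := [[0, 1, 3]]) (L' := [[2, 5, 4]]) (by decide) (by decide)
      (by decide) (by decide)
  have heb : EvenlyBalanced b :=
    evenlyBalanced_prod_map_formPerm (L := [[Sum.inr 1, Sum.inr 4, Sum.inr 2]])
      (L' := [[Sum.inr 3, Sum.inr 5, Sum.inl y]]) (by simp) (by simp) (by simp) (by simp; decide)
  have hbl (x : α) (hx : x ≠ y) : b (Sum.inl x) = Sum.inl x := by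
    simp [hb, swap_apply_def, hx]
  have hb0 : b (Sum.inr 0) = Sum.inr 0 := by
    simp [hb, swap_apply_def]
  -- The only old point moved by `b` is `y`, which `ρ` fixes.
  have hd : Perm.Disjoint (Perm.sumCongr ρ (1 : Perm (Fin 6))) b := by
    rintro (x | i)
    · by_cases hx : x = y
      · left; simp [hx, hy]
      · exact Or.inr (hbl x hx)
    · left; simp
  have hmul : Perm.sumCongr τ a * (Perm.sumCongr ρ 1 * b) =
      Perm.sumCongr (τ * ρ) 1 * (Sum.inl y :: newPoints α).formPerm := by
    rw [formPerm_cons_newPoints, ← ha, ← hb, ← mul_assoc, ← mul_assoc, Perm.sumCongr_mul,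
      Perm.sumCongr_mul, mul_one, mul_one, one_mul]
  have hnew : ∀ z ∈ newPoints α, Perm.sumCongr (τ * ρ) (1 : Perm (Fin 6)) z = z := by
    intro z hz
    obtain ⟨i, -, rfl⟩ := List.mem_map.1 hz
    simp
  have hlen : (newPoints α).length = 6 := by simp [newPoints]
  have hyl : Perm.sumCongr (τ * ρ) (1 : Perm (Fin 6)) (Sum.inl y) ≠ Sum.inl y := by
    simpa using hy'
  have hcyc : ((Perm.sumCongr (τ * ρ) (1 : Perm (Fin 6))).cycleOf (Sum.inl y)) =
      Perm.sumCongr ((τ * ρ).cycleOf y) 1 := cycleOf_sumCongr_one hy'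
  have hcc : ((Perm.sumCongr (τ * ρ) (1 : Perm (Fin 6))).cycleOf (Sum.inl y)).support.card =
      ((τ * ρ).cycleOf y).support.card := by
    rw [hcyc, ← sum_cycleType, ← sum_cycleType, cycleType_sumCongr_one_right]
  have htype : (Perm.sumCongr τ a * (Perm.sumCongr ρ 1 * b)).cycleType =
      (((τ * ρ).cycleOf y).support.card + 6) ::ₘ r := by
    rw [hmul, cycleType_mul_formPerm (nodup_cons_newPoints y) hnew hyl (r := r), hcc, hlen]
    rw [cycleType_sumCongr_one_right, hcc, hr]
  obtain ⟨hs₁, hs₂⟩ := SameCycle.mul_formPerm (nodup_cons_newPoints y) hnew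
  rw [← hmul] at hs₁ hs₂
  have hs₃ {x w : α} (h : SameCycle (τ * ρ) x w) : SameCycle
      (Perm.sumCongr τ a * (Perm.sumCongr ρ 1 * b)) (Sum.inl x) (Sum.inl w) := hs₁ h.sumCongr_one
  have hs₄ (i : Fin 6) : SameCycle (Perm.sumCongr τ a * (Perm.sumCongr ρ 1 * b)) (Sum.inl y)
      (Sum.inr i) := hs₂ _ (by simp [newPoints])
  have hz : (Perm.sumCongr ρ (1 : Perm (Fin 6)) * b) (Sum.inr 0) = Sum.inr 0 := by
    rw [Perm.mul_apply, hb0]; rfl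
  refine ⟨α ⊕ Fin 6, inferInstance, inferInstance, Perm.sumCongr τ a, Perm.sumCongr ρ 1 * b, ?_,
    hτ.sumCongr hea, ((hρ.sumCongr evenlyBalanced_one).mul_of_disjoint heb hd), htype, ?_⟩
  · rw [Fintype.card_sum, hcard, hr, Multiset.sum_cons, Multiset.sum_cons, Fintype.card_fin]
    omega
  · rintro (x | i)
    · obtain ⟨w, hw, hw'⟩ := hfix x
      -- The new right factor moves `y`. If `y` was the witness for its cycle, the new point 0 of
      -- that cycle takes over.
      by_cases hwy : w = y
      · subst hwy
        exact ⟨Sum.inr 0, (hs₃ hw).trans (hs₄ 0), Or.inr hz⟩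
      · refine ⟨Sum.inl w, hs₃ hw, hw'.imp (fun h => ?_) fun h => ?_⟩
        · simp [h]
        · rw [Perm.mul_apply, hbl w hwy]; simp [h]
    · exact ⟨Sum.inr 0, (hs₄ i).symm.trans (hs₄ 0), Or.inr hz⟩

/-- A cycle of length `n` contains a point fixed by a factor. If the left factor fixes it, inverting
the product exchanges the roles of the factors and keeps the cycle type. -/
theorem ExtendableType.add_six {n : ℕ} {r : Multiset ℕ} (h : ExtendableType (n ::ₘ r)) :
    ExtendableType ((n + 6) ::ₘ r) := by
  obtain ⟨α, _, _, τ, ρ, hcard, hτ, hρ, hm, hfix⟩ := h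
  have hn : n ∈ (τ * ρ).cycleType := by rw [hm]; simp
  obtain ⟨c, τ', hc, hd, hcyc, hcn⟩ := mem_cycleType_iff.1 hn
  obtain ⟨x, hx⟩ := hcyc.nonempty_support
  obtain ⟨y, hxy, hy⟩ := hfix x
  have hcx : c = (τ * ρ).cycleOf x := eq_cycleOf_of_disjoint hc hd hcyc hx
  have hyn : ((τ * ρ).cycleOf y).support.card = n := by
    rw [← hxy.cycleOf_eq, ← hcx, hcn]
  have hyy : (τ * ρ) y ≠ y := by
    rw [← two_le_card_support_cycleOf_iff, hyn]
    exact two_le_of_mem_cycleType hn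
  rcases hy with hy | hy
  · have hinv : (τ * ρ)⁻¹ = ρ⁻¹ * τ⁻¹ := mul_inv_rev τ ρ
    have hct : (ρ⁻¹ * τ⁻¹).cycleType = n ::ₘ r := by rw [← hinv, cycleType_inv, hm]
    have hco : ((ρ⁻¹ * τ⁻¹).cycleOf y).support.card = n := by
      rw [← hinv, ← hyn, ← support_inv ((τ * ρ).cycleOf y), cycleOf_inv]; congr!
    rw [← hco]
    refine extendableType_add_six hρ.inv hτ.inv (fun x => ?_) (inv_eq_iff_eq.2 hy.symm) ?_
      (by rw [hco, hct]) (by rw [hct, hcard])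
    · obtain ⟨w, hw, hw'⟩ := hfix x
      refine ⟨w, by rw [← hinv]; exact hw.inv, hw'.symm.imp ?_ ?_⟩ <;>
        exact fun h => inv_eq_iff_eq.2 h.symm
    · rw [← hinv, Ne, inv_eq_iff_eq]
      exact fun h => hyy h.symm
  · rw [← hyn]
    exact extendableType_add_six hτ hρ hfix hy hyy (by rw [hyn, hm]) (by rw [hm, hcard])

/-! ### Tables of factorizations -/

/-- Factorizations in which each cycle of the product contains a point fixed by a factor. -/
def extendableFactorizations : List Factorization := [
  ⟨7, [[1, 5, 0]], [[6, 3, 2]], [[4, 1, 3]], [[6, 5, 2]], [[0, 1, 2, 3, 4, 5, 6]]⟩,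
  ⟨8, [[7, 2, 5]], [[0, 6, 1]], [[0, 6, 5]], [[3, 4, 2]], [[0, 1], [2, 3, 4, 5, 6, 7]]⟩,
  ⟨10, [[4, 9, 2]], [[6, 5, 8]], [[6, 7, 5, 8, 4]], [[2, 3, 0, 1, 9]], [[0, 1, 2, 3], [4, 5, 6,
    7, 8, 9]]⟩,
  ⟨12, [[9, 1, 6]], [[5, 10, 2]], [[3, 4, 2], [11, 1, 10]], [[7, 8, 6], [0, 9, 5]], [[0, 1, 2,
    3, 4, 5], [6, 7, 8, 9, 10, 11]]⟩,
  ⟨8, [[6, 7, 2]], [[4, 3, 0]], [[7, 0, 1]], [[2, 4, 5]], [[0, 1, 2, 3], [4, 5, 6, 7]]⟩,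
  ⟨6, [[3, 4, 5]], [[2, 0, 1]], [], [], [[0, 1, 2], [3, 4, 5]]⟩,
  ⟨10, [], [], [[2, 3, 4, 0, 1]], [[9, 5, 6, 7, 8]], [[0, 1, 2, 3, 4], [5, 6, 7, 8, 9]]⟩,
  ⟨8, [[7, 0, 1]], [[5, 2, 4]], [[7, 3, 2]], [[5, 6, 1]], [[0, 1, 2], [3, 4, 5, 6, 7]]⟩,
  ⟨8, [], [], [[3, 2], [1, 0]], [[6, 7], [4, 5]], [[0, 1], [2, 3], [4, 5], [6, 7]]⟩,
  ⟨9, [[6, 3, 4]], [[2, 7, 5]], [[0, 1], [7, 8]], [[4, 5], [6, 2]], [[0, 1], [2, 3, 4], [5, 6,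
    7, 8]]⟩,
  ⟨9, [[3, 2, 1]], [[7, 5, 6]], [[1, 0, 2]], [[4, 7, 8]], [[0, 1], [2, 3], [4, 5, 6, 7, 8]]⟩,
  ⟨11, [[9, 8], [2, 5]], [[0, 1], [10, 6]], [[7, 9, 6]], [[4, 2, 3]], [[0, 1], [2, 3, 4, 5], [6,
    7, 8, 9, 10]]⟩,
  ⟨10, [[7, 0], [1, 3]], [[4, 8], [9, 5]], [[6, 0, 3, 8, 5]], [[2, 7, 4, 9, 1]], [[0, 1, 2], [3,
    4, 5, 6, 7, 8, 9]]⟩,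
  ⟨12, [[6, 1, 5], [2, 7, 8]], [[10, 11, 9], [0, 3, 4]], [[2, 0, 6]], [[8, 11, 1]], [[0, 1, 2,
    3, 4], [5, 6, 7, 8, 9, 10, 11]]⟩,
  ⟨11, [[10, 1, 0]], [[5, 3, 8]], [[7, 3, 2, 5, 6]], [[10, 4, 8, 9, 0]], [[0, 1], [2, 3], [4, 5,
    6, 7, 8, 9, 10]]⟩,
  ⟨13, [[12, 6, 3, 4, 5]], [[7, 9, 10, 11, 2]], [[8, 7], [11, 5]], [[2, 6], [0, 1]], [[0, 1],
    [2, 3, 4, 5], [6, 7, 8, 9, 10, 11, 12]]⟩,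
  ⟨11, [[5, 8], [10, 9]], [[6, 7], [3, 2]], [[0, 1], [7, 5]], [[10, 8], [4, 3]], [[0, 1], [2, 3,
    4], [5, 6, 7, 8, 9, 10]]⟩,
  ⟨13, [[1, 7], [8, 12]], [[9, 11], [4, 5]], [[0, 7, 12, 1], [10, 9]], [[3, 5, 6, 2], [8, 11]],
    [[0, 1], [2, 3, 4, 5, 6], [7, 8, 9, 10, 11, 12]]⟩,
  ⟨12, [[4, 5], [2, 7]], [[8, 11], [0, 10]], [[3, 7, 11, 6, 2]], [[1, 10, 8, 9, 0]], [[0, 1],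
    [2, 3], [4, 5], [6, 7, 8, 9, 10, 11]]⟩,
  ⟨14, [[5, 6, 4]], [[8, 2, 10]], [[9, 2, 3, 8], [1, 0]], [[12, 13, 10, 11], [7, 6]], [[0, 1],
    [2, 3], [4, 5, 6, 7], [8, 9, 10, 11, 12, 13]]⟩,
  ⟨13, [[8, 6, 11]], [[4, 9, 3]], [[12, 7, 11], [4, 5, 8]], [[2, 0, 1], [9, 10, 6]], [[0, 1, 2],
    [3, 4, 5, 6], [7, 8, 9, 10, 11, 12]]⟩,
  ⟨15, [[8, 5], [11, 9]], [[14, 12], [0, 3]], [[5, 6, 7], [8, 4], [10, 9]], [[1, 2, 0], [14,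
    11], [13, 12]], [[0, 1, 2, 3], [4, 5, 6, 7, 8], [9, 10, 11, 12, 13, 14]]⟩,
  ⟨15, [[13, 14, 10], [7, 8], [12, 11]], [[0, 1, 2], [3, 6], [5, 4]], [[5, 3], [9, 14]], [[10,
    12], [6, 8]], [[0, 1, 2], [3, 4, 5, 6, 7, 8], [9, 10, 11, 12, 13, 14]]⟩,
  ⟨17, [[12, 13, 11], [14, 15], [9, 2]], [[5, 4, 10], [7, 3], [1, 0]], [[7, 8, 2], [15, 16,
    13]], [[5, 6, 3], [9, 4, 1]], [[0, 1, 2, 3, 4], [5, 6, 7, 8, 9, 10], [11, 12, 13, 14, 15,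
    16]]⟩,
  ⟨11, [[2, 3], [1, 9]], [[4, 5], [7, 6]], [[0, 9, 10, 6, 2]], [[3, 5, 7, 8, 1]], [[0, 1, 2],
    [3, 4, 5, 6], [7, 8, 9, 10]]⟩,
  ⟨13, [[11, 12, 8, 5], [3, 9]], [[1, 2, 0, 6], [10, 4]], [[5, 0, 6, 7, 10]], [[9, 4, 8, 3, 2]],
    [[0, 1, 2, 3], [4, 5, 6, 7], [8, 9, 10, 11, 12]]⟩,
  ⟨12, [], [], [[11, 8, 9, 10], [3, 2]], [[7, 4, 5, 6], [1, 0]], [[0, 1], [2, 3], [4, 5, 6, 7],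
    [8, 9, 10, 11]]⟩,
  ⟨14, [[13, 4, 5], [1, 0], [8, 7]], [[10, 11, 3], [12, 2], [6, 9]], [[6, 8], [3, 13]], [[11,
    2], [12, 5]], [[0, 1], [2, 3, 4, 5], [6, 7, 8, 9], [10, 11, 12, 13]]⟩,
  ⟨11, [[2, 4], [7, 5]], [[0, 10], [9, 8]], [[1, 4, 7, 9, 0]], [[6, 5, 3, 2, 10]], [[0, 1, 2],
    [3, 4, 5], [6, 7, 8, 9, 10]]⟩,
  ⟨10, [[0, 7, 4, 5, 1]], [[6, 2, 3, 8, 9]], [[7, 3, 6]], [[0, 5, 9]], [[0, 1], [2, 3], [4, 5,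
    6], [7, 8, 9]]⟩,
  ⟨12, [[11, 0, 8, 9, 10]], [[7, 5, 4, 2, 6]], [[11, 0, 1]], [[5, 2, 3]], [[0, 1], [2, 3, 4],
    [5, 6, 7], [8, 9, 10, 11]]⟩,
  ⟨13, [[4, 12, 6]], [[10, 5, 9]], [[12, 8, 5], [1, 2, 0]], [[4, 10, 11], [6, 7, 3]], [[0, 1,
    2], [3, 4, 5, 6, 7], [8, 9, 10, 11, 12]]⟩,
  ⟨15, [[7, 9, 6, 8], [14, 4]], [[3, 11, 12, 1], [13, 0]], [[10, 3, 14], [9, 5], [0, 12]], [[6,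
    8, 7], [2, 1], [13, 4]], [[0, 1, 2, 3, 4], [5, 6, 7, 8, 9], [10, 11, 12, 13, 14]]⟩,
  ⟨14, [[13, 9, 7], [5, 8, 4]], [[6, 12, 0], [3, 2, 10]], [[0, 1, 12, 7, 5]], [[6, 9, 2, 10,
    11]], [[0, 1], [2, 3], [4, 5, 6, 7, 8], [9, 10, 11, 12, 13]]⟩,
  ⟨16, [[11, 12, 8, 10, 5]], [[7, 13, 15, 3, 4]], [[6, 4, 10], [8, 9], [1, 0]], [[15, 5, 2],
    [12, 7], [13, 14]], [[0, 1], [2, 3, 4, 5], [6, 7, 8, 9, 10], [11, 12, 13, 14, 15]]⟩,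
  ⟨12, [[1, 6, 0]], [[3, 2, 4]], [[7, 8, 9, 10, 11]], [[6, 2, 4, 5, 1]], [[0, 1], [2, 3], [4, 5,
    6], [7, 8, 9, 10, 11]]⟩,
  ⟨14, [[9, 10, 11, 12], [7, 6]], [[3, 4, 2, 13], [1, 0]], [[12, 2, 13]], [[5, 7, 8]], [[0, 1],
    [2, 3, 4], [5, 6, 7, 8], [9, 10, 11, 12, 13]]⟩,
  ⟨13, [[3, 2, 5, 4], [10, 12]], [[1, 7, 6, 0], [9, 8]], [[11, 10], [12, 9]], [[4, 2], [1, 6]],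
    [[0, 1], [2, 3], [4, 5], [6, 7], [8, 9, 10, 11, 12]]⟩,
  ⟨14, [[6, 7], [3, 2]], [[11, 13], [9, 8]], [[5, 4], [10, 13]], [[1, 0], [12, 11]], [[0, 1],
    [2, 3], [4, 5], [6, 7], [8, 9], [10, 11, 12, 13]]⟩,
  ⟨13, [[7, 8, 3]], [[4, 10, 12]], [[3, 2, 8, 6], [10, 11]], [[5, 12, 9, 4], [1, 0]], [[0, 1],
    [2, 3], [4, 5], [6, 7, 8], [9, 10, 11, 12]]⟩,
  ⟨15, [[9, 10, 6]], [[12, 14, 11]], [[9, 10, 14], [2, 3], [0, 1]], [[7, 8, 6], [5, 4], [13,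
    12]], [[0, 1], [2, 3], [4, 5], [6, 7, 8, 9], [10, 11, 12, 13, 14]]⟩,
  ⟨15, [[9, 14, 3], [7, 8], [1, 0]], [[10, 11, 12], [4, 6], [5, 13]], [[8, 3, 2, 14, 10]], [[12,
    5, 4, 13, 9]], [[0, 1], [2, 3], [4, 5, 6], [7, 8, 9, 10], [11, 12, 13, 14]]⟩,
  ⟨17, [[11, 13, 2, 3, 16, 5], [15, 14]], [[0, 1, 12, 9, 10, 4], [6, 7]], [[11, 8, 12], [3, 13,
    15]], [[1, 4, 16], [5, 7, 10]], [[0, 1], [2, 3], [4, 5, 6, 7], [8, 9, 10, 11], [12, 13, 14,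
    15, 16]]⟩,
  ⟨9, [[4, 2], [6, 0]], [[1, 5], [7, 8]], [[0, 5], [4, 1]], [[6, 8], [2, 3]], [[0, 1, 2, 3, 4,
    5, 6, 7, 8]]⟩,
  ⟨11, [[8, 9], [5, 7]], [[3, 0], [1, 6]], [[7, 9, 10, 3, 4]], [[0, 6, 5, 1, 2]], [[0, 1, 2, 3,
    4, 5, 6, 7, 8, 9, 10]]⟩,
  ⟨10, [[3, 8, 5]], [[6, 9, 0]], [[0, 1, 9, 2, 5]], [[3, 4, 8, 6, 7]], [[0, 1], [2, 3, 4, 5, 6,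
    7, 8, 9]]⟩,
  ⟨12, [[6, 5, 7], [9, 3, 8]], [[1, 2, 11], [0, 10, 4]], [[7, 3, 4, 6, 5]], [[11, 10, 2, 9, 0]],
    [[0, 1, 2, 3], [4, 5, 6, 7, 8, 9, 10, 11]]⟩,
  ⟨12, [[6, 7, 10, 5], [11, 2]], [[8, 9, 0, 1], [3, 4]], [[1, 9, 7]], [[2, 4, 10]], [[0, 1], [2,
    3, 4, 5, 6, 7, 8, 9, 10, 11]]⟩,
  ⟨13, [[0, 5], [9, 12]], [[6, 4], [10, 11]], [[8, 12, 6, 7], [11, 9]], [[5, 4, 0, 1], [3, 2]],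
    [[0, 1], [2, 3], [4, 5, 6, 7, 8, 9, 10, 11, 12]]⟩,
  ⟨13, [[0, 11, 1]], [[10, 12, 7]], [[9, 7, 8], [4, 2, 3]], [[11, 10, 0], [5, 6, 12]], [[0, 1],
    [2, 3, 4], [5, 6, 7, 8, 9, 10, 11, 12]]⟩,
  ⟨15, [[1, 7, 8, 9, 13, 14, 0]], [[12, 10, 11, 2, 4, 5, 6]], [[3, 2], [9, 12]], [[1, 14], [6,
    11]], [[0, 1], [2, 3, 4, 5, 6], [7, 8, 9, 10, 11, 12, 13, 14]]⟩,
  ⟨16, [[5, 4], [2, 3], [6, 11], [9, 8]], [[13, 14], [1, 0], [12, 15], [7, 10]], [[12, 14], [9,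
    7]], [[15, 11], [10, 6]], [[0, 1], [2, 3], [4, 5], [6, 7, 8, 9, 10, 11, 12, 13, 14, 15]]⟩,
  ⟨16, [[14, 7, 4, 5, 6, 13], [0, 1]], [[9, 10, 8, 11, 12, 15], [2, 3]], [[12, 6, 14]], [[10, 8,
    15]], [[0, 1], [2, 3], [4, 5, 6, 7], [8, 9, 10, 11, 12, 13, 14, 15]]⟩]

theorem valid_extendableFactorizations :
    ∀ F ∈ extendableFactorizations, F.Valid ∧ F.Extendable := by decide +kernel

/-- Further factorizations of fixed-point-free permutations. -/
def otherFactorizations : List Factorization := [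
  ⟨10, [[3, 2], [5, 4]], [[1, 8], [0, 6]], [[7, 1, 6]], [[8, 9, 0]], [[0, 1], [2, 3], [4, 5],
    [6, 7, 8, 9]]⟩,
  ⟨7, [[4, 6, 5]], [[0, 1, 2]], [[4, 6, 5]], [[2, 3, 1]], [[0, 1], [2, 3], [4, 5, 6]]⟩,
  ⟨9, [[4, 7], [5, 6]], [[8, 3], [2, 1]], [[8, 5], [2, 0]], [[7, 3], [4, 6]], [[0, 1, 2], [3, 4,
    5], [6, 7, 8]]⟩,
  ⟨11, [[0, 2], [1, 3]], [[7, 6], [9, 8]], [[0, 3], [5, 4]], [[9, 10], [1, 2]], [[0, 1], [2, 3],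
    [4, 5], [6, 7], [8, 9, 10]]⟩,
  ⟨12, [[6, 3, 2, 7], [1, 5]], [[8, 10, 11, 9], [4, 0]], [[5, 0], [4, 1]], [[8, 11], [6, 2]],
    [[0, 1], [2, 3], [4, 5], [6, 7], [8, 9], [10, 11]]⟩]

theorem valid_otherFactorizations : ∀ F ∈ otherFactorizations,
    F.Valid ∧ F.size = (F.cyc.map List.length).sum := by decide +kernel

/-- Factorizations of special atoms on six or seven points. -/
def specialFactorizations : List Factorization := [
  ⟨6, [[1, 0, 2]], [[3, 4, 5]], [[4, 3, 5]], [[0, 2, 1]], [[0, 1, 2]]⟩,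
  ⟨6, [[3, 1, 4]], [[2, 5, 0]], [[5, 2, 4]], [[1, 0, 3]], [[0, 1, 2, 3, 4]]⟩,
  ⟨6, [[0, 3, 5]], [[1, 2, 4]], [[2, 0, 4]], [[3, 1, 5]], [[0, 1], [2, 3]]⟩,
  ⟨7, [[5, 6, 4]], [[0, 3, 2]], [[5, 3, 6]], [[1, 2, 0]], [[0, 1], [2, 3, 4, 5]]⟩]

theorem valid_specialFactorizations : ∀ F ∈ specialFactorizations, F.Valid := by decide +kernel

/-! ### Types with small entries -/

/-- Multisets that are cycle types of even permutations. -/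
def IsEvenType (m : Multiset ℕ) : Prop :=
  (∀ n ∈ m, 2 ≤ n) ∧ Even (m.sum + Multiset.card m)

/-- The cycle types of the special atoms. -/
def specialTypes : List (Multiset ℕ) := [{3}, {5}, {2, 2}, {2, 4}]

/-- The cycle types of the explicit factorizations of fixed-point-free permutations. -/
def baseTypes : List (Multiset ℕ) :=
  (extendableFactorizations ++ otherFactorizations).map Factorization.type

theorem decomposableTypeOn_of_mem_baseTypes {m : Multiset ℕ} (h : m ∈ baseTypes) :
    DecomposableTypeOn m.sum m := by
  obtain ⟨F, hF, rfl⟩ := List.mem_map.1 h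
  have hs (h : F.size = (F.cyc.map List.length).sum) : F.type.sum = F.size := by
    rw [h, Factorization.type, Multiset.sum_coe]
  rcases List.mem_append.1 hF with hF | hF
  · obtain ⟨h₁, h₂⟩ := valid_extendableFactorizations F hF
    rw [hs h₂.1]
    exact h₁.decomposableTypeOn
  · obtain ⟨h₁, h₂⟩ := valid_otherFactorizations F hF
    rw [hs h₂]
    exact h₁.decomposableTypeOn

theorem extendableType_of_mem {m : Multiset ℕ}
    (h : m ∈ extendableFactorizations.map Factorization.type) : ExtendableType m := by
  obtain ⟨F, hF, rfl⟩ := List.mem_map.1 h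
  obtain ⟨h₁, h₂⟩ := valid_extendableFactorizations F hF
  exact h₁.extendableType h₂

/-- Small types one of which occurs in each nonspecial type with entries at most seven. -/
def coreTypes : List (Multiset ℕ) :=
  [{7}, {2, 6}, {4, 6}, {6, 6}, {4, 4}, {3, 3}, {5, 5}, {3, 5}, {2, 2, 2, 2}, {2, 2, 2, 4},
    {2, 2, 3}, {2, 3, 4}, {2, 2, 5}, {2, 4, 5}]

theorem coreTypes_subset : ∀ t ∈ coreTypes, t ∈ baseTypes := by decide +kernel

/-- This repairs a bad splitting: when removing the core type `t` leaves a special atom `s`, another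
tabulated type, possibly all of `t + s`, leaves a nonspecial remainder. -/
theorem exists_baseType_le_core_add_special : ∀ t ∈ coreTypes, ∀ s ∈ specialTypes,
    ∃ b ∈ baseTypes, b ≤ t + s ∧ t + s - b ∉ specialTypes := by decide +kernel

theorem isEvenType_of_mem_baseTypes : ∀ m ∈ baseTypes, 2 ≤ m.sum ∧ Even (m.sum + m.card) := by
  decide +kernel

theorem IsEvenType.of_add {m n : Multiset ℕ} (h : IsEvenType (m + n))
    (hm : Even (m.sum + Multiset.card m)) : IsEvenType n := by
  refine ⟨fun a ha => h.1 a (Multiset.mem_add.2 (Or.inr ha)), ?_⟩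
  have := h.2
  rw [Multiset.sum_add, Multiset.card_add, add_add_add_comm] at this
  exact (Nat.even_add.1 this).1 hm

theorem exists_eq_replicate {m : Multiset ℕ} (h2 : ∀ n ∈ m, 2 ≤ n) (h7 : ∀ n ∈ m, n ≤ 7) :
    ∃ a b c d e f : ℕ, m = Multiset.replicate a 2 + Multiset.replicate b 3 +
      Multiset.replicate c 4 + Multiset.replicate d 5 + Multiset.replicate e 6 +
      Multiset.replicate f 7 := by
  refine ⟨m.count 2, m.count 3, m.count 4, m.count 5, m.count 6, m.count 7, ?_⟩
  ext n
  by_cases hn : n ∈ m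
  · have := h2 n hn
    have := h7 n hn
    interval_cases n <;> simp [Multiset.count_replicate]
  · rw [Multiset.count_eq_zero_of_notMem hn]
    simp only [Multiset.count_add, Multiset.count_replicate]
    split_ifs <;> simp_all

/-- Avoiding every core type bounds the multiplicities of 2, ..., 7. Together with parity this
leaves only the empty type and the four special ones. -/
theorem exists_coreType_le {m : Multiset ℕ} (hm : IsEvenType m) (hm7 : ∀ n ∈ m, n ≤ 7)
    (h0 : m ≠ 0) (hs : m ∉ specialTypes) : ∃ t ∈ coreTypes, t ≤ m := by
  obtain ⟨a, b, c, d, e, f, rfl⟩ := exists_eq_replicate hm.1 hm7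
  have hpar := hm.2
  simp only [Multiset.sum_add, Multiset.card_add, Multiset.sum_replicate, Multiset.card_replicate,
    smul_eq_mul] at hpar
  have hle (t : Multiset ℕ) (ht : ∀ n ∈ t, 2 ≤ n ∧ n ≤ 7) (h : t.count 2 ≤ a ∧ t.count 3 ≤ b ∧
      t.count 4 ≤ c ∧ t.count 5 ≤ d ∧ t.count 6 ≤ e ∧ t.count 7 ≤ f) :
      t ≤ Multiset.replicate a 2 + Multiset.replicate b 3 +
      Multiset.replicate c 4 + Multiset.replicate d 5 + Multiset.replicate e 6 +
      Multiset.replicate f 7 := by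
    rw [Multiset.le_iff_count]
    intro n
    by_cases hn : n ∈ t
    · obtain ⟨h₁, h₂⟩ := ht n hn
      interval_cases n <;> simp [Multiset.count_replicate] <;> tauto
    · rw [Multiset.count_eq_zero_of_notMem hn]; exact Nat.zero_le _
  by_contra! hcon
  have hno (t : Multiset ℕ) (ht : t ∈ coreTypes) : ¬ (t.count 2 ≤ a ∧ t.count 3 ≤ b ∧
      t.count 4 ≤ c ∧ t.count 5 ≤ d ∧ t.count 6 ≤ e ∧ t.count 7 ≤ f) := fun h =>
    hcon t ht (hle t ((by decide +kernel : ∀ t ∈ coreTypes, ∀ n ∈ t, 2 ≤ n ∧ n ≤ 7) t ht) h)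
  have h1 : ¬ (1 ≤ f) := by
    simpa using hno {7} (by decide +kernel)
  have h2 : ¬ (1 ≤ a ∧ 1 ≤ e) := by
    simpa using hno {2, 6} (by decide +kernel)
  have h3 : ¬ (1 ≤ c ∧ 1 ≤ e) := by
    simpa using hno {4, 6} (by decide +kernel)
  have h4 : ¬ (2 ≤ e) := by
    simpa using hno {6, 6} (by decide +kernel)
  have h5 : ¬ (2 ≤ c) := by
    simpa using hno {4, 4} (by decide +kernel)
  have h6 : ¬ (2 ≤ b) := by
    simpa using hno {3, 3} (by decide +kernel)
  have h7 : ¬ (2 ≤ d) := by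
    simpa using hno {5, 5} (by decide +kernel)
  have h8 : ¬ (1 ≤ b ∧ 1 ≤ d) := by
    simpa using hno {3, 5} (by decide +kernel)
  have h9 : ¬ (4 ≤ a) := by
    simpa using hno {2, 2, 2, 2} (by decide +kernel)
  have h10 : ¬ (3 ≤ a ∧ 1 ≤ c) := by
    simpa using hno {2, 2, 2, 4} (by decide +kernel)
  have h11 : ¬ (2 ≤ a ∧ 1 ≤ b) := by
    simpa using hno {2, 2, 3} (by decide +kernel)
  have h12 : ¬ (1 ≤ a ∧ 1 ≤ b ∧ 1 ≤ c) := by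
    simpa using hno {2, 3, 4} (by decide +kernel)
  have h13 : ¬ (2 ≤ a ∧ 1 ≤ d) := by
    simpa using hno {2, 2, 5} (by decide +kernel)
  have h14 : ¬ (1 ≤ a ∧ 1 ≤ c ∧ 1 ≤ d) := by
    simpa using hno {2, 4, 5} (by decide +kernel)
  clear hcon hno hle hm hm7
  -- An even permutation has an even number of cycles of even length.
  have hpar' : Even (a + c + e) := by
    have h : a * 2 + b * 3 + c * 4 + d * 5 + e * 6 + f * 7 + (a + b + c + d + e + f) =
        2 * (a + 2 * b + 2 * c + 3 * d + 3 * e + 4 * f) + (a + c + e) := by ring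
    rw [h, Nat.even_add] at hpar
    exact hpar.1 (even_two_mul _)
  clear hpar
  obtain ⟨k, hk⟩ := hpar'
  have hf : f = 0 := by omega
  have he : e = 0 := by omega
  have hc : c ≤ 1 := by omega
  have hb : b ≤ 1 := by omega
  have hd : d ≤ 1 := by omega
  have ha : a ≤ 3 := by omega
  subst hf he
  have hcases : (a = 0 ∧ b = 0 ∧ c = 0 ∧ d = 0) ∨ (a = 0 ∧ b = 1 ∧ c = 0 ∧ d = 0) ∨
      (a = 0 ∧ b = 0 ∧ c = 0 ∧ d = 1) ∨ (a = 2 ∧ b = 0 ∧ c = 0 ∧ d = 0) ∨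
      (a = 1 ∧ b = 0 ∧ c = 1 ∧ d = 0) := by
    clear hs h0
    interval_cases b <;> interval_cases d <;> interval_cases c <;> simp at * <;> omega
  rcases hcases with ⟨rfl, rfl, rfl, rfl⟩ | ⟨rfl, rfl, rfl, rfl⟩ | ⟨rfl, rfl, rfl, rfl⟩ |
    ⟨rfl, rfl, rfl, rfl⟩ | ⟨rfl, rfl, rfl, rfl⟩
  · exact h0 (by simp)
  all_goals exact hs (by decide +kernel)

/-! ### Types with a large entry -/

theorem ExtendableType.add_mul_six {n : ℕ} {r : Multiset ℕ} (h : ExtendableType (n ::ₘ r)) (a : ℕ) :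
    ExtendableType ((n + 6 * a) ::ₘ r) := by
  induction a with
  | zero => exact h
  | succ a ih => rw [mul_add, mul_one, ← add_assoc]; exact ih.add_six

/-- The cycle types of the explicit extendable factorizations. -/
def extendableTypes : List (Multiset ℕ) := extendableFactorizations.map Factorization.type

theorem extendableType_add_six_of_mem {n : ℕ} {r : Multiset ℕ}
    (h : (n + 6) ::ₘ r ∈ extendableTypes ∨ n ::ₘ r ∈ extendableTypes) :
    ExtendableType ((n + 6) ::ₘ r) :=
  h.elim extendableType_of_mem fun h => (extendableType_of_mem h).add_six

theorem extendableType_odd_cons : ∀ n, Odd n → 7 ≤ n → ∀ r ∈ 0 :: specialTypes,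
    ExtendableType (n ::ₘ r) := by
  intro n hn h7 r hr
  -- One representative modulo 6 suffices. The smaller type `n ::ₘ r` need not be in the extendable
  -- table, for instance `{3, 2, 2}`; then the entry with `n + 6` is.
  have base : ∀ n ∈ [1, 3, 5], ∀ r ∈ 0 :: specialTypes,
      (n + 6) ::ₘ r ∈ extendableTypes ∨ n ::ₘ r ∈ extendableTypes := by decide +kernel
  obtain ⟨k, hk⟩ := hn
  obtain ⟨n₀, a, h₀, rfl⟩ : ∃ n₀ a, n₀ ∈ [1, 3, 5] ∧ n = n₀ + 6 + 6 * a :=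
    ⟨(n - 7) % 6 + 1, (n - 7) / 6, by simp; omega, by omega⟩
  exact (extendableType_add_six_of_mem (base n₀ h₀ r hr)).add_mul_six a

theorem extendableType_even_cons {r : Multiset ℕ} (h : ∀ n ∈ [2, 4, 6], ExtendableType ((n + 6) ::ₘ r))
    {n : ℕ} (hn : Even n) (h8 : 8 ≤ n) : ExtendableType (n ::ₘ r) := by
  obtain ⟨k, hk⟩ := hn
  obtain ⟨n₀, a, h₀, rfl⟩ : ∃ n₀ a, n₀ ∈ [2, 4, 6] ∧ n = n₀ + 6 + 6 * a :=
    ⟨(n - 8) % 6 + 2, (n - 8) / 6, by simp; omega, by omega⟩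
  exact (h n₀ h₀).add_mul_six a

/-- Both even cycles can be lengthened independently, so both lengths reduce modulo 6 to tabulated
cases. -/
theorem extendableType_even_cons_cons {n k : ℕ} (hn : Even n) (h8 : 8 ≤ n) (hk : Even k)
    (h2 : 2 ≤ k) : ∀ r ∈ ([0, {3}, {5}] : List (Multiset ℕ)),
    ExtendableType (n ::ₘ k ::ₘ r) := by
  intro r hr
  have base : ∀ n ∈ [2, 4, 6], ∀ k ∈ [2, 4, 6], ∀ r ∈ ([0, {3}, {5}] : List (Multiset ℕ)),
      (n + 6) ::ₘ k ::ₘ r ∈ extendableTypes ∨ n ::ₘ k ::ₘ r ∈ extendableTypes := by decide +kernel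
  refine extendableType_even_cons (fun n₁ hn₁ => ?_) hn h8
  obtain ⟨l, hl⟩ := hk
  obtain ⟨k₀, a, h₀, rfl⟩ : ∃ k₀ a, k₀ ∈ [2, 4, 6] ∧ k = k₀ + 6 * a :=
    ⟨(k - 2) % 6 + 2, (k - 2) / 6, by simp; omega, by omega⟩
  rw [Multiset.cons_swap]
  refine ExtendableType.add_mul_six ?_ a
  rw [Multiset.cons_swap]
  exact extendableType_add_six_of_mem (base n₁ hn₁ k₀ h₀ r hr)

theorem extendableType_even_cons_triple {n : ℕ} (hn : Even n) (h8 : 8 ≤ n) :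
    ∀ r ∈ ([{2, 2, 2}, {2, 2, 4}] : List (Multiset ℕ)), ExtendableType (n ::ₘ r) := by
  intro r hr
  have base : ∀ n ∈ [2, 4, 6], ∀ r ∈ ([{2, 2, 2}, {2, 2, 4}] : List (Multiset ℕ)),
      (n + 6) ::ₘ r ∈ extendableTypes ∨ n ::ₘ r ∈ extendableTypes := by decide +kernel
  exact extendableType_even_cons (fun n₁ hn₁ => extendableType_add_six_of_mem (base n₁ hn₁ r hr))
    hn h8

/-- Each entry `k` contributes `k + 1` to the parity. This supplies the partner for a large even
entry. -/
theorem exists_even_mem {m : Multiset ℕ} (h : ¬ Even (m.sum + Multiset.card m)) :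
    ∃ k ∈ m, Even k := by
  by_contra! hcon
  apply h
  induction m using Multiset.induction with
  | empty => simp
  | cons a m ih =>
    have ha := Nat.not_even_iff_odd.1 (hcon a (by simp))
    rw [Multiset.sum_cons, Multiset.card_cons, show a + m.sum + (Multiset.card m + 1) =
      (a + 1) + (m.sum + Multiset.card m) by ring]
    refine ha.add_one.add (by_contra fun h' => h' (ih h' fun k hk => hcon k (by simp [hk])))

/-! ### The induction over nonspecial types -/

theorem DecomposableTypeOn.add_sum {m n : Multiset ℕ} (hm : DecomposableTypeOn m.sum m)
    (hn : DecomposableTypeOn n.sum n) : DecomposableTypeOn (m + n).sum (m + n) := by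
  rw [Multiset.sum_add]; exact hm.add hn

theorem le_five_of_mem_specialTypes : ∀ s ∈ specialTypes, ∀ a ∈ s, a ≤ 5 := by decide +kernel

theorem IsEvenType.decomposableTypeOn {m : Multiset ℕ} (hm : IsEvenType m) (hs : m ∉ specialTypes) :
    DecomposableTypeOn m.sum m := by
  induction hN : m.sum using Nat.strong_induction_on generalizing m with
  | _ N ih =>
  subst hN
  -- The inductive step: a nonempty even decomposable piece `t` may be removed whenever the
  -- remainder is not special.
  have split (t r : Multiset ℕ) (hmt : m = t + r) (ht : DecomposableTypeOn t.sum t)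
      (hte : Even (t.sum + Multiset.card t)) (ht0 : 0 < t.sum) (hr : r ∉ specialTypes) :
      DecomposableTypeOn m.sum m := by
    subst hmt
    exact ht.add_sum (ih r.sum (by rw [Multiset.sum_add]; omega) (hm.of_add hte) hr rfl)
  by_cases h7 : ∀ n ∈ m, n ≤ 7
  · by_cases h0 : m = 0
    · subst h0; exact decomposableTypeOn_zero
    obtain ⟨t, ht, htm⟩ := exists_coreType_le hm h7 h0 hs
    have key (b : Multiset ℕ) (hb : b ∈ baseTypes) (hbm : b ≤ m) (hbs : m - b ∉ specialTypes) :
        DecomposableTypeOn m.sum m := by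
      obtain ⟨h₁, h₂⟩ := isEvenType_of_mem_baseTypes b hb
      exact split b (m - b) (add_tsub_cancel_of_le hbm).symm
        (decomposableTypeOn_of_mem_baseTypes hb) h₂ (by omega) hbs
    by_cases hr : m - t ∈ specialTypes
    · obtain ⟨b, hb, hbm, hbs⟩ := exists_baseType_le_core_add_special t ht _ hr
      rw [add_tsub_cancel_of_le htm] at hbm hbs
      exact key b hb hbm hbs
    · exact key t (coreTypes_subset t ht) htm hr
  push Not at h7
  obtain ⟨n, hn, hn7⟩ := h7
  obtain ⟨r, rfl⟩ := Multiset.exists_cons_of_mem hn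
  rcases Nat.even_or_odd n with hne | hno
  · have hpar := hm.2
    have hr : ¬ Even (r.sum + Multiset.card r) := by
      rw [Multiset.sum_cons, Multiset.card_cons, show n + r.sum + (Multiset.card r + 1) =
        n + (r.sum + Multiset.card r + 1) by ring, Nat.even_add, Nat.even_add_one] at hpar
      exact hpar.1 hne
    obtain ⟨k, hk, hke⟩ := exists_even_mem hr
    obtain ⟨r, rfl⟩ := Multiset.exists_cons_of_mem hk
    have hk2 : 2 ≤ k := hm.1 k (by simp)
    have pair (j : ℕ) (hj : Even j) (hj2 : 2 ≤ j) :
        DecomposableTypeOn (n ::ₘ {j} : Multiset ℕ).sum (n ::ₘ {j}) :=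
      (extendableType_even_cons_cons hne hn7 hj hj2 0 (by simp)).decomposableTypeOn
    have pair_even (j : ℕ) (hj : Even j) :
        Even ((n ::ₘ {j} : Multiset ℕ).sum + Multiset.card (n ::ₘ {j} : Multiset ℕ)) := by
      simpa using (hne.add hj).add even_two
    by_cases hrs : r ∈ specialTypes
    · simp only [specialTypes, List.mem_cons, List.not_mem_nil, or_false] at hrs
      rcases hrs with rfl | rfl | rfl | rfl
      · exact (extendableType_even_cons_cons hne hn7 hke hk2 {3} (by simp)).decomposableTypeOn
      · exact (extendableType_even_cons_cons hne hn7 hke hk2 {5} (by simp)).decomposableTypeOn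
      -- The type is `{n, k, 2, 2}`. Pairing `n` with a 2 instead of `k` leaves `{k, 2}`, which is
      -- special only for `k = 2` or `k = 4`; those two cases come from the triples.
      · by_cases hk2s : ({k, 2} : Multiset ℕ) ∈ specialTypes
        · have hk4 : k = 2 ∨ k = 4 := by
            have := le_five_of_mem_specialTypes _ hk2s k (by simp)
            obtain ⟨l, rfl⟩ := hke
            omega
          rcases hk4 with rfl | rfl
          · exact (extendableType_even_cons_triple hne hn7 {2, 2, 2} (by simp)).decomposableTypeOn
          · rw [show (4 ::ₘ {2, 2} : Multiset ℕ) = {2, 2, 4} by decide]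
            exact (extendableType_even_cons_triple hne hn7 {2, 2, 4} (by simp)).decomposableTypeOn
        · refine split (n ::ₘ {2}) {k, 2} ?_ (pair 2 even_two le_rfl) (pair_even 2 even_two)
            (by simp) hk2s
          simp only [← Multiset.singleton_add, Multiset.insert_eq_cons]; abel
      · by_cases hk2s : ({k, 2} : Multiset ℕ) ∈ specialTypes
        · have hk4 : k = 2 ∨ k = 4 := by
            have := le_five_of_mem_specialTypes _ hk2s k (by simp)
            obtain ⟨l, rfl⟩ := hke
            omega
          rcases hk4 with rfl | rfl
          · exact (extendableType_even_cons_triple hne hn7 {2, 2, 4} (by simp)).decomposableTypeOn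
          -- Here the type is `{n, 4, 2, 4}`; pairing `n` with the 2 leaves the nonspecial `{4, 4}`.
          · refine split (n ::ₘ {2}) {4, 4} ?_ (pair 2 even_two le_rfl) (pair_even 2 even_two)
              (by simp) (by decide +kernel)
            simp only [← Multiset.singleton_add, Multiset.insert_eq_cons]; abel
        · refine split (n ::ₘ {4}) {k, 2} ?_ (pair 4 (by decide) (by omega))
            (pair_even 4 (by decide)) (by simp) hk2s
          simp only [← Multiset.singleton_add, Multiset.insert_eq_cons]; abel
    · exact split (n ::ₘ {k}) r (by simp) (pair k hke hk2) (pair_even k hke) (by simp; omega) hrs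
  · by_cases hr : r ∈ specialTypes
    · exact (extendableType_odd_cons n hno (by omega) r (by simp [hr])).decomposableTypeOn
    · refine split {n} r (by simp) ?_ ?_ (by simp; omega) hr
      · exact (extendableType_odd_cons n hno (by omega) 0 (by simp)).decomposableTypeOn
      · simpa using hno.add_one

/-! ### The exception on six points -/

/-- Half the cycle type has sum at most 3, hence at most one entry, 2 or 3; evenness of the half
excludes 2. -/
theorem EvenlyBalanced.eq_one_or_of_card_eq_six {X : Type*} [Fintype X] [DecidableEq X]
    (hX : Fintype.card X = 6) {τ : Perm X} (h : EvenlyBalanced τ) :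
    τ = 1 ∨ τ.cycleType = {3, 3} := by
  obtain ⟨k, hk, he⟩ := h.exists_cycleType
  have hsum : k.sum + k.sum ≤ 6 := by
    rw [← Multiset.sum_add, ← hk, ← hX]; exact sum_cycleType_le τ
  have h2 : ∀ a ∈ k, 2 ≤ a := fun a ha =>
    two_le_of_mem_cycleType (σ := τ) (by rw [hk]; exact Multiset.mem_add.2 (Or.inl ha))
  induction k using Multiset.induction with
  | empty => exact Or.inl (cycleType_eq_zero.1 hk)
  | cons a k _ =>
    induction k using Multiset.induction with
    | empty =>
      right
      have ha := h2 a (by simp)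
      simp only [Multiset.sum_cons, Multiset.sum_zero, Multiset.card_cons, Multiset.card_zero]
        at hsum he
      have ha3 : a = 3 := by
        obtain ⟨j, hj⟩ := he
        omega
      subst ha3
      exact hk
    | cons b k _ =>
      have ha := h2 a (by simp)
      have hb := h2 b (by simp)
      simp only [Multiset.sum_cons] at hsum
      omega

/-- The hypotheses on each factor say that its type is `{3, 3}`, and the conclusion forbids order 4
for the product. Stating those on `τ` before quantifying over `ρ` leaves only 40 choices of `τ` for
the inner search. -/
theorem not_two_four_fin_six : ∀ τ : Perm (Fin 6), (∀ i, τ i ≠ i) → (∀ i, τ (τ (τ i)) = i) →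
    ∀ ρ : Perm (Fin 6), (∀ i, ρ i ≠ i) → (∀ i, ρ (ρ (ρ i)) = i) →
    (∀ i, τ (ρ (τ (ρ (τ (ρ (τ (ρ i))))))) = i) → ∀ i, τ (ρ (τ (ρ i))) = i := by
  decide +kernel

theorem forall_ne_of_cycleType_eq {X : Type*} [Fintype X] [DecidableEq X]
    (hX : Fintype.card X = 6) {τ : Perm X} (h : τ.cycleType = {3, 3}) : ∀ x, τ x ≠ x := by
  intro x
  have hs : τ.support = Finset.univ := by
    rw [← Finset.card_eq_iff_eq_univ, ← sum_cycleType, h, hX]; rfl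
  rw [← mem_support, hs]
  exact Finset.mem_univ x

theorem pow_three_eq_one_of_cycleType_eq {X : Type*} [Fintype X] [DecidableEq X] {τ : Perm X}
    (h : τ.cycleType = {3, 3}) : τ ^ 3 = 1 := by
  rw [← orderOf_dvd_iff_pow_eq_one, ← lcm_cycleType, h]
  decide

theorem not_decomposable_of_card_eq_six {X : Type*} [Fintype X] [DecidableEq X]
    (hX : Fintype.card X = 6) {σ : Perm X} (h : σ.cycleType = {2, 4}) : ¬ Decomposable σ := by
  rintro ⟨τ, ρ, hτ, hρ, rfl⟩
  rcases hτ.eq_one_or_of_card_eq_six hX with rfl | hτ₃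
  · rw [one_mul] at h
    rcases hρ.eq_one_or_of_card_eq_six hX with rfl | hρ₃
    · simp at h
    · rw [hρ₃] at h; exact absurd h (by decide)
  rcases hρ.eq_one_or_of_card_eq_six hX with rfl | hρ₃
  · rw [mul_one, hτ₃] at h; exact absurd h (by decide)
  have ho : orderOf (τ * ρ) = 4 := by rw [← lcm_cycleType, h]; decide
  have h4 : (τ * ρ) ^ 4 = 1 := by rw [← ho]; exact pow_orderOf_eq_one _
  have h2 : (τ * ρ) ^ 2 ≠ 1 := by
    rw [Ne, ← orderOf_dvd_iff_pow_eq_one, ho]; decide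
  obtain ⟨e⟩ := Fintype.card_eq.1 (hX.trans (Fintype.card_fin 6).symm)
  have hcube {g : Perm X} (hg : g.cycleType = {3, 3}) (x : X) : g (g (g x)) = x :=
    DFunLike.congr_fun (pow_three_eq_one_of_cycleType_eq hg) x
  have hne {g : Perm X} (hg : g.cycleType = {3, 3}) (i : Fin 6) : e.permCongr g i ≠ i := by
    rw [permCongr_apply, Ne, ← e.eq_symm_apply]
    exact forall_ne_of_cycleType_eq hX hg _
  have hfour (x : X) : τ (ρ (τ (ρ (τ (ρ (τ (ρ x))))))) = x := DFunLike.congr_fun h4 x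
  refine h2 (Equiv.ext fun x => ?_)
  have key := not_two_four_fin_six (e.permCongr τ) (hne hτ₃) (by simp [permCongr_apply, hcube hτ₃])
    (e.permCongr ρ) (hne hρ₃) (by simp [permCongr_apply, hcube hρ₃])
    (by simp [permCongr_apply, hfour]) (e x)
  simpa [permCongr_apply, pow_two] using key

/-! ### Special atoms and the final assembly -/

theorem decomposableTypeOn_special : ∀ s ∈ specialTypes,
    DecomposableTypeOn (if s = {2, 4} then 7 else 6) s := by
  have h : ∀ s ∈ specialTypes, ∃ F ∈ specialFactorizations,
      F.type = s ∧ F.size = if s = {2, 4} then 7 else 6 := by decide +kernel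
  intro s hs
  obtain ⟨F, hF, rfl, hsize⟩ := h s hs
  rw [← hsize]
  exact (valid_specialFactorizations F hF).decomposableTypeOn

theorem mainTheorem6 {X : Type*} [Fintype X] [DecidableEq X]
    (σ : Equiv.Perm X) (hσ : Equiv.Perm.sign σ = 1) :
    (¬ IsSpecialAtom σ → Decomposable σ) ∧
    (6 ≤ Fintype.card X →
      (σ.cycleType = {3} ∨ σ.cycleType = {5} ∨ σ.cycleType = {2, 2}) → Decomposable σ) ∧
    (7 ≤ Fintype.card X → σ.cycleType = {2, 4} → Decomposable σ) ∧
    (6 ≤ Fintype.card X →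
      (Fintype.card X = 6 ∧ σ.cycleType = {2, 4}) ∨ Decomposable σ) ∧
    (Fintype.card X = 6 → σ.cycleType = {2, 4} → ¬ Decomposable σ) := by
  have h₁ : ¬ IsSpecialAtom σ → Decomposable σ := by
    intro hs
    have he : IsEvenType σ.cycleType :=
      ⟨fun _ => two_le_of_mem_cycleType, (sign_eq_one_iff_cycleType σ).1 hσ⟩
    refine (he.decomposableTypeOn fun h => hs ?_).decomposable (sum_cycleType_le σ)
    simpa [specialTypes, IsSpecialAtom] using h
  have h₂ : 6 ≤ Fintype.card X →
      (σ.cycleType = {3} ∨ σ.cycleType = {5} ∨ σ.cycleType = {2, 2}) → Decomposable σ := by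
    rintro hX h
    have hmem : σ.cycleType ∈ specialTypes := by
      rcases h with h | h | h <;> simp [specialTypes, h]
    have hne : σ.cycleType ≠ {2, 4} := by
      rcases h with h | h | h <;> rw [h] <;> decide
    have := decomposableTypeOn_special _ hmem
    rw [if_neg hne] at this
    exact this.decomposable hX
  have h₃ : 7 ≤ Fintype.card X → σ.cycleType = {2, 4} → Decomposable σ := by
    intro hX h
    have := decomposableTypeOn_special _ (show σ.cycleType ∈ specialTypes by simp [specialTypes, h])
    rw [if_pos h] at this
    exact this.decomposable hX
  refine ⟨h₁, h₂, h₃, fun hX => ?_, fun hX h => not_decomposable_of_card_eq_six hX h⟩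
  by_cases hs : IsSpecialAtom σ
  · rcases hs with h | h | h | h
    · exact Or.inr (h₂ hX (Or.inl h))
    · exact Or.inr (h₂ hX (Or.inr (Or.inl h)))
    · exact Or.inr (h₂ hX (Or.inr (Or.inr h)))
    · rcases hX.eq_or_lt with h6 | h7
      · exact Or.inl ⟨h6.symm, h⟩
      · exact Or.inr (h₃ h7 h)
  · exact Or.inr (h₁ hs)
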